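/- Throughout, rings are associative with identity. Let $R$ be a ring. A right $R$-module $M$ is called max-projective if, for every maximal right ideal $I$ of $R$, every homomorphism $M\to R/I$ factors through the canonical projection $R\to R/I$. The ring $R$ is called right max-QF if every injective right $R$-module is max-projective; right small if $R_R$ is a small (superfluous) submodule of its injective hull $E(R_R)$, that is, $R+X=E(R_R)$ for a submodule $X$ only if $X=E(R_R)$; right semihereditary if every finitely generated right ideal of $R$ is projective; semilocal if $R/J(R)$ is semisimple Artinian, where $J(R)$ is the Jacobson radical; indecomposable if $R\neq 0$ and $R$ is not isomorphic to a product of two nonzero rings (equivalently, its only central idempotents are $0$ and $1$). (1) Let $R$ be an indecomposable semilocal right semihereditary ring. Then $R$ is right max-QF if and only if $R$ is semisimple Artinian or right small. (2) In particular, let $R$ be a local right semihereditary ring. Then $R$ is right max-QF if and only if $R$ is right small or a division ring. -/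

import Mathlib

/-!
Right modules over a ring `R` are modules over `Rᵐᵒᵖ`; in particular `R` carries its natural right
module structure `Semiring.toOppositeModule` (`MulOpposite.op r • x = x * r`), and right ideals of
`R` are terms of `Submodule Rᵐᵒᵖ R`.
-/

universe u

namespace MaxQF

section Modules

variable {S : Type*} [Ring S]

/-- A submodule `N` of `M` is small (superfluous) if `N + L = M` implies `L = M`. -/
def IsSmallSubmodule {M : Type*} [AddCommGroup M] [Module S M] (N : Submodule S M) : Prop :=
  ∀ L : Submodule S M, N ⊔ L = ⊤ → L = ⊤

/-- A submodule `N` of `M` is essential if it meets every nonzero submodule nontrivially. -/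
def IsEssentialSubmodule {M : Type*} [AddCommGroup M] [Module S M] (N : Submodule S M) : Prop :=
  ∀ L : Submodule S M, N ⊓ L = ⊥ → L = ⊥

/-- A map `i : M → E` exhibits `E` as an injective hull of `M`: `E` is injective and `i` is a
monomorphism with essential image. -/
structure IsInjectiveHull {M E : Type*} [AddCommGroup M] [Module S M] [AddCommGroup E] [Module S E]
    (i : M →ₗ[S] E) : Prop where
  injective_module : Module.Injective S E
  injective_map : Function.Injective i
  essential : IsEssentialSubmodule (LinearMap.range i)

end Modules

/-- A ring `R` is right small if `R`, as a right module over itself, is a small submodule of its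
injective hull `E(R_R)` (which is unique up to isomorphism over `R`). -/
def IsRightSmall (R : Type u) [Ring R] : Prop :=
  ∃ (E : Type u) (_ : AddCommGroup E) (_ : Module Rᵐᵒᵖ E) (i : R →ₗ[Rᵐᵒᵖ] E),
    IsInjectiveHull i ∧ IsSmallSubmodule (LinearMap.range i)

/-- A right `R`-module `M` is max-projective if, for every maximal right ideal `I` of `R`, every
homomorphism `M → R/I` factors through the canonical projection `R → R/I`. -/
def IsMaxProjective (R : Type*) [Ring R] (M : Type*) [AddCommGroup M] [Module Rᵐᵒᵖ M] : Prop :=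
  ∀ I : Submodule Rᵐᵒᵖ R, IsCoatom I → ∀ f : M →ₗ[Rᵐᵒᵖ] R ⧸ I,
    ∃ g : M →ₗ[Rᵐᵒᵖ] R, I.mkQ ∘ₗ g = f

/-- A ring is right max-QF if every injective right module over it is max-projective. -/
def IsRightMaxQF (R : Type u) [Ring R] : Prop :=
  ∀ (E : Type u) [AddCommGroup E] [Module Rᵐᵒᵖ E],
    Module.Injective Rᵐᵒᵖ E → IsMaxProjective R E

/-- A ring is right semihereditary if all its finitely generated right ideals are projective. -/
def IsRightSemihereditary (R : Type*) [Ring R] : Prop :=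
  ∀ I : Submodule Rᵐᵒᵖ R, I.FG → Module.Projective Rᵐᵒᵖ I

/-- A ring `R` is semilocal if `R/J(R)` is semisimple Artinian. -/
def IsSemilocal (R : Type*) [Ring R] : Prop :=
  IsSemisimpleRing (R ⧸ Ring.jacobson R)

/-- A nonzero ring is indecomposable if it is not a product of two nonzero rings, i.e. if its only
central idempotents are `0` and `1`. -/
def IsIndecomposableRing (R : Type*) [Ring R] : Prop :=
  Nontrivial R ∧ ∀ e : R, IsIdempotentElem e → e ∈ Subring.center R → e = 0 ∨ e = 1

/-- A ring is a division ring if it is nonzero and every nonzero element is a unit. -/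
def IsDivisionRing (R : Type*) [Ring R] : Prop :=
  Nontrivial R ∧ ∀ a : R, a ≠ 0 → IsUnit a

end MaxQF

/-!
The substance is that a right max-QF ring that is indecomposable, semilocal and right semihereditary
is semisimple as soon as it is not right small.

Let `A` be the trace in `R` of the injective right modules: the set of values of homomorphisms from
injective modules to `R`. It is a two-sided ideal.

* *`A` is generated by an idempotent.* If `g : E → R` has injective source and `B ≤ range g` is a
  finitely generated right ideal, then `B` is projective, so its inclusion into `R` lifts to `E`, and
  the lift extends to `R → E`; composing with `g` gives `b ∈ range g` acting as a left identity on
  `B` (`exists_mem_range_mul_eq_self`). Since `(1 - b)R` is projective as well, `b` can be replaced by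
  an idempotent (`exists_isIdempotentElem_range`). A semilocal ring has no infinite ascending chain
  of idempotents, so `A = eR` with `e` idempotent (`exists_isIdempotentElem_injectiveTrace`). As `A`
  is a left ideal, `(1 - e)Re = 0`, and the same left identities give `J(R)e = 0`.
* *`e` is central.* Let `K = {x | xe = 0}`, a two-sided ideal containing `J(R)`. The right module
  `R/K` is injective (`injective_quotient_leftAnnihilator`): a homomorphism from a right ideal to
  `R/K` factors through its image in the semisimple ring `R/J(R)`. As `R` is max-QF,
  each projection `R/K → R/I` with `I ≥ K` maximal lifts to `R`, and the image of `1` is an element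
  outside `I` which annihilates `K` on the left. Hence this annihilator and `K` span `R`, which forces
  `eR(1 - e) = 0` (`mul_mul_one_sub_eq_zero`).
* *Conclusion.* If `R` is not right small, some homomorphism from its injective hull to a simple
  module is nonzero; lifting it to `R` shows `e ≠ 0`. By indecomposability `e = 1`, so `J(R) = 0` and
  `R` is semisimple.

Conversely, over a right small ring there is no nonzero homomorphism from an injective module to a
simple one, so that `0` always is a lift.
-/

namespace MaxQF

open MulOpposite

/-! ### Existence of injective hulls -/

section Hull

variable {S : Type u} [Ring S]

theorem exists_maximal_disjoint {M : Type*} [AddCommGroup M] [Module S M] {C D : Submodule S M}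
    (h : Disjoint D C) : ∃ D', D ≤ D' ∧ Maximal (fun X => Disjoint X C) D' := by
  refine zorn_le_nonempty₀ {X | Disjoint X C} (fun c hc hchain y hy => ?_) D h
  refine ⟨sSup c, ?_, fun z hz => le_sSup hz⟩
  exact (hchain.directedOn.disjoint_sSup_left).2 fun a ha => hc ha

theorem exists_injective_embedding (M : Type u) [AddCommGroup M] [Module S M] :
    ∃ (Q : Type u) (_ : AddCommGroup Q) (_ : Module S Q) (i : M →ₗ[S] Q),
      Module.Injective S Q ∧ Function.Injective i := by
  obtain ⟨p⟩ := CategoryTheory.EnoughInjectives.presentation (ModuleCat.of S M)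
  have hinj : CategoryTheory.Injective p.J := p.injective
  refine ⟨p.J, inferInstance, inferInstance, p.f.hom,
    Module.injective_module_of_injective_object S p.J, ?_⟩
  have := p.mono
  exact (ModuleCat.mono_iff_injective p.f).1 this

theorem injective_of_retract {Q N : Type u} [AddCommGroup Q] [Module S Q] [AddCommGroup N]
    [Module S N] (hQ : Module.Injective S Q) (s : N →ₗ[S] Q) (p : Q →ₗ[S] N)
    (h : ∀ x, p (s x) = x) : Module.Injective S N where
  out X Y _ _ _ _ f hf g := by
    obtain ⟨k, hk⟩ := hQ.out f hf (s ∘ₗ g)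
    exact ⟨p ∘ₗ k, fun x => by simp [hk, h]⟩

/-- Every module `M` has an injective hull. Inside an injective module containing `M`, take `C`
maximal disjoint from `M` and then `N ≥ M` maximal disjoint from `C`. Then `M` is essential in
`N`, and `N` is a direct summand with complement `C`. -/
theorem exists_isInjectiveHull (M : Type u) [AddCommGroup M] [Module S M] :
    ∃ (E : Type u) (_ : AddCommGroup E) (_ : Module S E) (i : M →ₗ[S] E), IsInjectiveHull i := by
  obtain ⟨Q, _, _, i, hQ, hi⟩ := exists_injective_embedding (S := S) M
  obtain ⟨C, -, hC⟩ := exists_maximal_disjoint (disjoint_bot_left : Disjoint ⊥ (LinearMap.range i))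
  obtain ⟨N, hMN, hN⟩ := exists_maximal_disjoint hC.prop.symm
  have hCN : ∀ X : Submodule S Q, C ≤ X → Disjoint X N → X ≤ C := fun X hCX hX =>
    hC.le_of_ge (hX.mono_right hMN) hCX
  have hess : ∀ L : Submodule S Q, L ≤ N → Disjoint (LinearMap.range i) L → L = ⊥ := by
    intro L hLN hL
    have hdisj : Disjoint (C ⊔ L) (LinearMap.range i) := by
      rw [Submodule.disjoint_def]
      rintro x hx hxi
      obtain ⟨c, hc, l, hl, rfl⟩ := Submodule.mem_sup.1 hx
      have hcN : c ∈ N := by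
        have := N.sub_mem (hMN hxi) (hLN hl)
        rwa [add_sub_cancel_right] at this
      have hc0 := Submodule.disjoint_def.1 hN.prop c hcN hc
      subst hc0
      rw [zero_add] at hxi ⊢
      exact Submodule.disjoint_def.1 hL l hxi hl
    have hLC : L ≤ C := le_sup_right.trans (hC.le_of_ge hdisj le_sup_left)
    exact le_bot_iff.1 (hN.prop hLN hLC)
  -- The inclusion of `N` factors through its embedding into `Q ⧸ C`.
  have hkinj : Function.Injective (C.mkQ ∘ₗ N.subtype) := by
    rw [← LinearMap.ker_eq_bot, LinearMap.ker_eq_bot']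
    intro x hx
    have : (x : Q) ∈ C := by simpa using hx
    exact Subtype.ext (Submodule.disjoint_def.1 hN.prop x x.2 this)
  obtain ⟨h, hh⟩ := hQ.out (C.mkQ ∘ₗ N.subtype) hkinj N.subtype
  have hh' : ∀ n ∈ N, h (C.mkQ n) = n := fun n hn => hh ⟨n, hn⟩
  have hker : ∀ q, h (C.mkQ q) ∈ C → q ∈ C := by
    intro q hq
    refine hCN (C.comap (h ∘ₗ C.mkQ)) (fun c hc => ?_) ?_ hq
    · have : C.mkQ c = 0 := by simpa using hc
      simp [this]
    · rw [Submodule.disjoint_def]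
      intro x hx hxN
      refine Submodule.disjoint_def.1 hN.prop x hxN ?_
      have hx' : h (C.mkQ x) ∈ C := hx
      rwa [hh' x hxN] at hx'
  have hrange : ∀ q, h (C.mkQ q) ∈ N := by
    intro q
    refine hN.le_of_ge (y := LinearMap.range (h ∘ₗ C.mkQ)) ?_ (fun n hn => ⟨n, hh' n hn⟩) ⟨q, rfl⟩
    rw [Submodule.disjoint_def]
    rintro _ ⟨x, rfl⟩ hx
    have : C.mkQ x = 0 := by simpa using hker x hx
    simp [this]
  have hiN : ∀ m, i m ∈ N := fun m => hMN ⟨m, rfl⟩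
  refine ⟨N, inferInstance, inferInstance, i.codRestrict N hiN, ?_, ?_, ?_⟩
  · exact injective_of_retract hQ N.subtype ((h ∘ₗ C.mkQ).codRestrict N hrange)
      fun x => Subtype.ext (hh' x x.2)
  · intro x y hxy
    exact hi (congrArg Subtype.val hxy)
  · intro L hL
    have := hess (L.map N.subtype) (Submodule.map_subtype_le N L) ?_
    · refine Submodule.map_injective_of_injective N.subtype_injective ?_
      rw [this, Submodule.map_bot]
    · rw [Submodule.disjoint_def]
      rintro _ ⟨m, rfl⟩ ⟨l, hl, hlm⟩
      have hmem : l ∈ LinearMap.range (i.codRestrict N hiN) ⊓ L :=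
        ⟨⟨m, Subtype.ext hlm.symm⟩, hl⟩
      rw [hL, Submodule.mem_bot] at hmem
      rw [← hlm, hmem, map_zero]

end Hull

variable {R : Type u} [Ring R]

/-! ### Right small rings and homomorphisms to simple modules -/

/-- The homomorphism of right modules `R → M` sending `1` to `x`. -/
def ofElement {M : Type*} [AddCommGroup M] [Module Rᵐᵒᵖ M] (x : M) : R →ₗ[Rᵐᵒᵖ] M where
  toFun r := op r • x
  map_add' a b := by rw [op_add, add_smul]
  map_smul' a b := by simp [mul_smul]

@[simp]
theorem ofElement_apply {M : Type*} [AddCommGroup M] [Module Rᵐᵒᵖ M] (x : M) (r : R) :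
    ofElement x r = op r • x := rfl

theorem map_mul_right {N : Type*} [AddCommGroup N] [Module Rᵐᵒᵖ N] (f : R →ₗ[Rᵐᵒᵖ] N) (a b : R) :
    f (a * b) = op b • f a := by
  rw [← map_smul, op_smul_eq_mul]

instance finite_self_mulOpposite : Module.Finite Rᵐᵒᵖ R :=
  Module.Finite.of_surjective (ofElement (1 : R) ∘ₗ
    ({ toFun := unop, map_add' := fun _ _ => rfl, map_smul' := fun _ _ => rfl } : Rᵐᵒᵖ →ₗ[Rᵐᵒᵖ] R))
    fun r => ⟨op r, by simp⟩

/-- If `f : E → R ⧸ I` is nonzero at `x`, extend `R → E`, `1 ↦ x`, to the injective hull. The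
composite with `f` maps `R` onto the simple module `R ⧸ I`, so `R` and the kernel of the composite
span the hull; as `R` is small, the composite is zero, a contradiction. -/
theorem isRightMaxQF_of_isRightSmall (h : IsRightSmall R) : IsRightMaxQF R := by
  obtain ⟨H, _, _, i, hi, hsmall⟩ := h
  intro E _ _ hE I hI f
  refine ⟨0, ?_⟩
  rw [LinearMap.comp_zero]
  by_contra hf
  obtain ⟨x, hx⟩ : ∃ x, f x ≠ 0 := by
    by_contra! hcon
    exact hf (LinearMap.ext hcon).symm
  obtain ⟨k, hk⟩ := hE.out i hi.injective_map (ofElement x)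
  have : IsSimpleModule Rᵐᵒᵖ (R ⧸ I) := isSimpleModule_iff_isCoatom.2 hI
  have hk1 : f (k (i 1)) = f x := by simp [hk]
  have htop : LinearMap.range (f ∘ₗ k ∘ₗ i) = ⊤ := by
    refine (eq_bot_or_eq_top _).resolve_left fun hbot => hx ?_
    have hmem : f (k (i 1)) ∈ LinearMap.range (f ∘ₗ k ∘ₗ i) := ⟨1, rfl⟩
    rwa [hbot, Submodule.mem_bot, hk1] at hmem
  have hker : LinearMap.ker (f ∘ₗ k) = ⊤ := by
    refine hsmall _ (eq_top_iff.2 fun y _ => ?_)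
    obtain ⟨r, hr⟩ : f (k y) ∈ LinearMap.range (f ∘ₗ k ∘ₗ i) := htop ▸ Submodule.mem_top
    refine Submodule.mem_sup.2 ⟨i r, ⟨r, rfl⟩, y - i r, ?_, add_sub_cancel _ _⟩
    have hr' : f (k (i r)) = f (k y) := hr
    simp [hr']
  have : i 1 ∈ LinearMap.ker (f ∘ₗ k) := hker ▸ Submodule.mem_top
  exact hx (hk1 ▸ this)

theorem isRightMaxQF_of_isSemisimpleRing [IsSemisimpleRing R] : IsRightMaxQF R := by
  intro E _ _ _ I _ f
  have : Module.Projective Rᵐᵒᵖ E := Module.projective_of_isSemisimpleRing Rᵐᵒᵖ E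
  exact Module.projective_lifting_property I.mkQ f I.mkQ_surjective

/-- If `R + L` is all of `E` with `L` proper, then `E ⧸ L` is cyclic, so it has a simple quotient. -/
theorem exists_map_ne_zero_of_not_isSmallSubmodule {E : Type*} [AddCommGroup E] [Module Rᵐᵒᵖ E]
    (i : R →ₗ[Rᵐᵒᵖ] E) (h : ¬ IsSmallSubmodule (LinearMap.range i)) :
    ∃ I : Submodule Rᵐᵒᵖ R, IsCoatom I ∧ ∃ f : E →ₗ[Rᵐᵒᵖ] R ⧸ I, f ≠ 0 := by
  obtain ⟨L, hL, hLtop⟩ : ∃ L, LinearMap.range i ⊔ L = ⊤ ∧ L ≠ ⊤ := by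
    simpa [IsSmallSubmodule] using h
  have hsurj : Function.Surjective (L.mkQ ∘ₗ i) := by
    intro y
    obtain ⟨y, rfl⟩ := L.mkQ_surjective y
    obtain ⟨_, ⟨r, rfl⟩, l, hl, rfl⟩ := Submodule.mem_sup.1 (hL ▸ Submodule.mem_top : y ∈ _)
    exact ⟨r, by simpa using hl⟩
  have hker : LinearMap.ker (L.mkQ ∘ₗ i) ≠ ⊤ := by
    intro hk
    refine hLtop (top_le_iff.1 (hL ▸ sup_le ?_ le_rfl))
    rintro _ ⟨r, rfl⟩
    have : r ∈ LinearMap.ker (L.mkQ ∘ₗ i) := hk ▸ Submodule.mem_top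
    simpa using this
  obtain ⟨I, hI, hle⟩ := (eq_top_or_exists_le_coatom _).resolve_left hker
  refine ⟨I, hI, Submodule.factor hle ∘ₗ
    ((L.mkQ ∘ₗ i).quotKerEquivOfSurjective hsurj).symm.toLinearMap ∘ₗ L.mkQ, fun h0 => ?_⟩
  have h1 := LinearMap.congr_fun h0 (i 1)
  have hq : ((L.mkQ ∘ₗ i).quotKerEquivOfSurjective hsurj).symm (L.mkQ (i 1)) =
      Submodule.mkQ _ (1 : R) := by
    rw [LinearEquiv.symm_apply_eq]
    rfl
  have h1I : (1 : R) ∈ I := by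
    have h0 : I.mkQ 1 = 0 := by
      simpa [-Submodule.mkQ_apply, hq, Submodule.factor_mk] using h1
    simpa using h0
  exact hI.1 (eq_top_iff.2 fun r _ => by simpa using I.smul_mem (op r) h1I)

/-! ### Idempotents in semihereditary and semilocal rings -/

theorem eq_zero_of_mem_jacobson_of_mul_eq {b x : R} (hb : b ∈ Ring.jacobson R) (h : b * x = x) :
    x = 0 := by
  rw [← Ideal.jacobson_bot] at hb
  obtain ⟨z, hz⟩ := Ideal.mem_jacobson_iff.1 hb (-1)
  have hz' : z * (1 - b) = 1 := by
    rw [Ideal.mem_bot] at hz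
    rw [← sub_eq_zero, ← hz]
    noncomm_ring
  calc x = z * (1 - b) * x := by rw [hz', one_mul]
    _ = 0 := by rw [mul_assoc, sub_mul, h, one_mul, sub_self, mul_zero]

/-- The right annihilator of `c` is generated by an idempotent, since `cR` is projective. -/
theorem exists_isIdempotentElem_mul_eq_zero_iff (hR : IsRightSemihereditary R) (c : R) :
    ∃ e : R, IsIdempotentElem e ∧ ∀ x, c * x = 0 ↔ e * x = x := by
  let m : R →ₗ[Rᵐᵒᵖ] R := DistribSMul.toLinearMap Rᵐᵒᵖ R c
  have hfg : (LinearMap.range m).FG := by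
    rw [LinearMap.range_eq_map]
    exact Module.Finite.fg_top.map m
  have := hR _ hfg
  obtain ⟨s, hs⟩ := LinearMap.exists_rightInverse_of_surjective m.rangeRestrict
    m.range_rangeRestrict
  have hms : ∀ y, c * s (m.rangeRestrict y) = c * y := fun y =>
    congrArg Subtype.val (LinearMap.congr_fun hs (m.rangeRestrict y))
  have hmul : ∀ x, s (m.rangeRestrict x) = s (m.rangeRestrict 1) * x := by
    intro x
    conv_lhs => rw [← one_mul x]
    exact map_mul_right (s ∘ₗ m.rangeRestrict) 1 x
  have hc : c * (1 - s (m.rangeRestrict 1)) = 0 := by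
    rw [mul_sub, hms, sub_self]
  have key : ∀ x, c * x = 0 → (1 - s (m.rangeRestrict 1)) * x = x := by
    intro x hx
    have h0 : m.rangeRestrict x = 0 := Subtype.ext hx
    rw [sub_mul, one_mul, ← hmul, h0, map_zero, sub_zero]
  refine ⟨1 - s (m.rangeRestrict 1), key _ hc, fun x => ⟨key x, fun hx => ?_⟩⟩
  rw [← hx, ← mul_assoc, hc, zero_mul]

theorem exists_mem_range_mul_eq_self (hR : IsRightSemihereditary R) {E : Type u} [AddCommGroup E]
    [Module Rᵐᵒᵖ E] (hE : Module.Injective Rᵐᵒᵖ E) (g : E →ₗ[Rᵐᵒᵖ] R) {B : Submodule Rᵐᵒᵖ R}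
    (hB : B.FG) (hBg : B ≤ LinearMap.range g) : ∃ b ∈ LinearMap.range g, ∀ x ∈ B, b * x = x := by
  have := hR B hB
  obtain ⟨l, hl⟩ := Module.projective_lifting_property g.rangeRestrict (Submodule.inclusion hBg)
    g.surjective_rangeRestrict
  obtain ⟨k, hk⟩ := hE.out B.subtype B.subtype_injective l
  refine ⟨g (k 1), ⟨k 1, rfl⟩, fun x hx => ?_⟩
  have h1 := map_mul_right (g ∘ₗ k) 1 x
  have h2 : g (k x) = x := by
    have hkx : k x = l ⟨x, hx⟩ := hk ⟨x, hx⟩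
    rw [hkx]
    exact congrArg Subtype.val (LinearMap.congr_fun hl ⟨x, hx⟩)
  rw [one_mul] at h1
  exact h1.symm.trans h2

theorem exists_isIdempotentElem_range (hR : IsRightSemihereditary R) {E : Type u} [AddCommGroup E]
    [Module Rᵐᵒᵖ E] (hE : Module.Injective Rᵐᵒᵖ E) (g : E →ₗ[Rᵐᵒᵖ] R) {B : Submodule Rᵐᵒᵖ R}
    (hB : B.FG) (hBg : B ≤ LinearMap.range g) :
    ∃ e ∈ LinearMap.range g, IsIdempotentElem e ∧ ∀ x ∈ B, e * x = x := by
  obtain ⟨b, hb, hbB⟩ := exists_mem_range_mul_eq_self hR hE g hB hBg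
  obtain ⟨e, he, hiff⟩ := exists_isIdempotentElem_mul_eq_zero_iff hR (1 - b)
  have hbe : e = b * e := by
    have := (hiff e).2 he
    rwa [sub_mul, one_mul, sub_eq_zero] at this
  refine ⟨e, ?_, he, fun x hx => (hiff x).1 ?_⟩
  · rw [hbe]
    exact (LinearMap.range g).smul_mem (op e) hb
  · rw [sub_mul, one_mul, hbB x hx, sub_self]

/-! ### The trace of the injective modules -/

variable (R) in
/-- The trace of the injective right modules in `R`: the elements lying in the image of some
homomorphism `E → R` with `E` injective. Sums need not be taken, since two such homomorphisms have
their images inside the image of one from the product. -/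
def injectiveTrace : Set R :=
  {x | ∃ (E : Type u) (_ : AddCommGroup E) (_ : Module Rᵐᵒᵖ E) (_ : Module.Injective Rᵐᵒᵖ E)
    (g : E →ₗ[Rᵐᵒᵖ] R), x ∈ LinearMap.range g}

theorem mul_left_mem_injectiveTrace (c : R) {x : R} (hx : x ∈ injectiveTrace R) :
    c * x ∈ injectiveTrace R := by
  obtain ⟨E, _, _, hE, g, y, rfl⟩ := hx
  exact ⟨E, _, _, hE, DistribSMul.toLinearMap Rᵐᵒᵖ R c ∘ₗ g, y, rfl⟩

theorem exists_isIdempotentElem_mem_injectiveTrace (hR : IsRightSemihereditary R) {x y : R}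
    (hx : x ∈ injectiveTrace R) (hy : y ∈ injectiveTrace R) :
    ∃ e ∈ injectiveTrace R, IsIdempotentElem e ∧ e * x = x ∧ e * y = y := by
  obtain ⟨E, _, _, hE, g, hx⟩ := hx
  obtain ⟨F, _, _, hF, k, hy⟩ := hy
  have hEF : Module.Injective Rᵐᵒᵖ (E × F) := ⟨fun X Y _ _ _ _ f hf p => by
    obtain ⟨a, ha⟩ := hE.out f hf (LinearMap.fst _ _ _ ∘ₗ p)
    obtain ⟨b, hb⟩ := hF.out f hf (LinearMap.snd _ _ _ ∘ₗ p)
    exact ⟨a.prod b, fun z => Prod.ext (ha z) (hb z)⟩⟩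
  have hle : Submodule.span Rᵐᵒᵖ {x, y} ≤ LinearMap.range (g.coprod k) := by
    rw [Submodule.span_le, LinearMap.range_coprod]
    rintro z (rfl | rfl)
    · exact Submodule.mem_sup_left hx
    · exact Submodule.mem_sup_right hy
  obtain ⟨e, he, hidem, heB⟩ := exists_isIdempotentElem_range hR hEF (g.coprod k)
    (Submodule.fg_span (by simp)) hle
  exact ⟨e, ⟨E × F, _, _, hEF, _, he⟩, hidem, heB x (Submodule.subset_span (by simp)),
    heB y (Submodule.subset_span (by simp))⟩

theorem exists_isIdempotentElem_injectiveTrace (hR : IsRightSemihereditary R)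
    (hs : IsSemilocal R) : ∃ e ∈ injectiveTrace R, IsIdempotentElem e ∧
      ∀ x ∈ injectiveTrace R, e * x = x := by
  have : IsSemisimpleRing (R ⧸ Ring.jacobson R) := hs
  -- For idempotents, `eR ≤ fR` means `R(1 - f) ≤ R(1 - e)`, and left ideals of `R ⧸ J(R)` satisfy
  -- the descending chain condition.
  let φ : R → Ideal (R ⧸ Ring.jacobson R) := fun e => Ideal.span {Ideal.Quotient.mk _ (1 - e)}
  have h0 : (0 : R) ∈ injectiveTrace R :=
    ⟨PUnit, inferInstance, inferInstance, ⟨fun _ _ _ _ _ _ _ _ _ => ⟨0, fun _ => rfl⟩⟩, 0,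
      Submodule.zero_mem _⟩
  obtain ⟨_, ⟨e, ⟨he, hidem⟩, rfl⟩, hmin⟩ := wellFounded_lt.has_min
    (φ '' {e | e ∈ injectiveTrace R ∧ IsIdempotentElem e})
    ⟨_, 0, ⟨h0, IsIdempotentElem.zero⟩, rfl⟩
  refine ⟨e, he, hidem, fun x hx => ?_⟩
  obtain ⟨f, hf, hfidem, hfe, hfx⟩ := exists_isIdempotentElem_mem_injectiveTrace hR he hx
  have hle : φ f ≤ φ e := by
    rw [Ideal.span_singleton_le_iff_mem, Ideal.mem_span_singleton']
    refine ⟨Ideal.Quotient.mk _ (1 - f), ?_⟩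
    rw [← map_mul]
    congr 1
    rw [mul_sub, mul_one, sub_mul, one_mul, hfe, sub_self, sub_zero]
  have hge : φ e ≤ φ f := by
    by_contra hcon
    exact hmin (φ f) ⟨f, ⟨hf, hfidem⟩, rfl⟩ (lt_of_le_not_ge hle hcon)
  rw [Ideal.span_singleton_le_iff_mem, Ideal.mem_span_singleton'] at hge
  obtain ⟨a, ha⟩ := hge
  have hd : (1 - e) * f ∈ Ring.jacobson R := by
    rw [← Ideal.Quotient.eq_zero_iff_mem, map_mul, ← ha, mul_assoc, ← map_mul, sub_mul, one_mul,
      hfidem.eq, sub_self, map_zero, mul_zero]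
  have hd0 : (1 - e) * f = 0 := by
    refine eq_zero_of_mem_jacobson_of_mul_eq hd ?_
    calc (1 - e) * f * ((1 - e) * f) = (1 - e) * (f * f - (f * e) * f) := by noncomm_ring
      _ = (1 - e) * f - (1 - e) * e * f := by rw [hfe, hfidem.eq, mul_sub, mul_assoc]
      _ = (1 - e) * f := by rw [hidem.one_sub_mul_self, zero_mul, sub_zero]
  rw [sub_mul, one_mul, sub_eq_zero] at hd0
  rw [← hfx, ← mul_assoc, ← hd0]

/-- If `e = g y`, the image of `x ↦ j * g x` contains `j * e` and lies in the Jacobson radical, so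
`j * e` has a left identity in the radical. -/
theorem jacobson_mul_eq_zero (hR : IsRightSemihereditary R) {e : R} (he : e ∈ injectiveTrace R)
    (hmul : ∀ x ∈ injectiveTrace R, e * x = x) {j : R} (hj : j ∈ Ring.jacobson R) : j * e = 0 := by
  obtain ⟨E, _, _, hE, g, y, hy⟩ := id he
  have hje : j * e * (j * e) = j * (j * e) := by
    rw [mul_assoc, hmul _ (mul_left_mem_injectiveTrace j he)]
  have hmem : j * e ∈ LinearMap.range (DistribSMul.toLinearMap Rᵐᵒᵖ R j ∘ₗ g) :=
    ⟨y, by rw [← hy]; rfl⟩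
  obtain ⟨_, ⟨z, rfl⟩, hb⟩ := exists_mem_range_mul_eq_self hR hE
    (DistribSMul.toLinearMap Rᵐᵒᵖ R j ∘ₗ g) (B := Submodule.span Rᵐᵒᵖ {j * e})
    (Submodule.fg_span (by simp)) (by simpa [Submodule.span_le] using hmem)
  refine eq_zero_of_mem_jacobson_of_mul_eq ?_ (hb _ (Submodule.mem_span_singleton_self _))
  exact (Ring.jacobson R).mul_mem_right (g z) hj

/-! ### Centrality of the idempotent -/

/-- The left annihilator `{x | x * e = 0}` of an element `e` with `Re ⊆ eR`, which is a two-sided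
ideal, considered as a right ideal. -/
def leftAnnihilator (e : R) (he : ∀ r, e * (r * e) = r * e) : Submodule Rᵐᵒᵖ R where
  carrier := {x | x * e = 0}
  add_mem' {a b} ha hb := by
    have ha' : a * e = 0 := ha
    have hb' : b * e = 0 := hb
    change (a + b) * e = 0
    rw [add_mul, ha', hb', add_zero]
  zero_mem' := zero_mul e
  smul_mem' r x hx := by
    have hx' : x * e = 0 := hx
    change x * unop r * e = 0
    rw [mul_assoc, ← he, ← mul_assoc, hx', zero_mul]

theorem mem_leftAnnihilator {e : R} {he : ∀ r, e * (r * e) = r * e} {x : R} :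
    x ∈ leftAnnihilator e he ↔ x * e = 0 := Iff.rfl

theorem injective_quotient_leftAnnihilator (hs : IsSemilocal R) {e : R}
    (hidem : IsIdempotentElem e) (he : ∀ r, e * (r * e) = r * e)
    (hJ : ∀ j ∈ Ring.jacobson R, j * e = 0) :
    Module.Injective Rᵐᵒᵖ (R ⧸ leftAnnihilator e he) := by
  have : IsSemisimpleRing (R ⧸ Ring.jacobson R) := hs
  refine Module.Baer.injective fun B φ => ?_
  have hzero : ∀ b : B, unop (b : Rᵐᵒᵖ) * e = 0 → φ b = 0 := by
    intro b hb
    have hb' : op (1 - e) • b = b := by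
      refine Subtype.ext (unop_injective ?_)
      change unop (b : Rᵐᵒᵖ) * (1 - e) = unop (b : Rᵐᵒᵖ)
      rw [mul_sub, hb, mul_one, sub_zero]
    obtain ⟨y, hy⟩ := Submodule.mkQ_surjective _ (φ b)
    rw [← hb', map_smul, ← hy, ← map_smul, Submodule.mkQ_apply, Submodule.Quotient.mk_eq_zero,
      mem_leftAnnihilator, op_smul_eq_mul, mul_assoc, hidem.one_sub_mul_self, mul_zero]
  -- The image of `B` in the semisimple ring `R ⧸ J(R)` is generated by an idempotent.
  let q : Rᵐᵒᵖ →+* (R ⧸ Ring.jacobson R)ᵐᵒᵖ := (Ideal.Quotient.mk (Ring.jacobson R)).op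
  have hq : Function.Surjective q := fun z => by
    obtain ⟨x, hx⟩ := Ideal.Quotient.mk_surjective (unop z)
    exact ⟨op x, unop_injective hx⟩
  obtain ⟨w, hw, hspan⟩ := IsSemisimpleRing.ideal_eq_span_idempotent (B.map q)
  obtain ⟨u, hu, rfl⟩ := (Ideal.mem_map_iff_of_surjective q hq).1
    (hspan ▸ Ideal.mem_span_singleton_self w : w ∈ B.map q)
  refine ⟨LinearMap.toSpanSingleton Rᵐᵒᵖ _ (φ ⟨u, hu⟩), fun x hx => ?_⟩
  rw [LinearMap.toSpanSingleton_apply, ← map_smul, ← sub_eq_zero, ← map_sub]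
  refine hzero _ (hJ _ ?_)
  have hqx : q x ∈ Ideal.span {q u} := hspan ▸ Ideal.mem_map_of_mem q hx
  obtain ⟨a, ha⟩ := Ideal.mem_span_singleton'.1 hqx
  have hq0 : q (x * u - x) = 0 := by
    rw [map_sub, map_mul, ← ha, mul_assoc, hw.eq, sub_self]
  rw [← Ideal.Quotient.eq_zero_iff_mem]
  exact op_injective hq0

theorem mul_mul_one_sub_eq_zero (hQF : IsRightMaxQF R) (hs : IsSemilocal R) {e : R}
    (hidem : IsIdempotentElem e) (he : ∀ r, e * (r * e) = r * e)
    (hJ : ∀ j ∈ Ring.jacobson R, j * e = 0) (r : R) : e * r * (1 - e) = 0 := by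
  let K := leftAnnihilator e he
  let N : Submodule Rᵐᵒᵖ R :=
    { carrier := {t | ∀ k ∈ K, t * k = 0}
      add_mem' := fun {a b} ha hb k hk => by rw [add_mul, ha k hk, hb k hk, add_zero]
      zero_mem' := fun k _ => zero_mul k
      smul_mem' := fun c t ht k hk => by
        change t * unop c * k = 0
        rw [mul_assoc]
        refine ht _ ?_
        change unop c * k * e = 0
        rw [mul_assoc, mem_leftAnnihilator.1 hk, mul_zero] }
  have htop : N ⊔ K = ⊤ := by
    refine (eq_top_or_exists_le_coatom (N ⊔ K)).resolve_right ?_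
    rintro ⟨I, hI, hle⟩
    obtain ⟨g, hg⟩ := hQF (R ⧸ K) (injective_quotient_leftAnnihilator hs hidem he hJ) I hI
      (Submodule.factor (le_sup_right.trans hle))
    have hN : g (K.mkQ 1) ∈ N := by
      intro k hk
      have hk0 : K.mkQ k = 0 := by simpa using hk
      have := map_mul_right (g ∘ₗ K.mkQ) 1 k
      rw [one_mul, LinearMap.comp_apply, hk0, map_zero] at this
      exact this.symm
    have h1 : I.mkQ (g (K.mkQ 1)) = I.mkQ 1 := LinearMap.congr_fun hg (K.mkQ 1)
    have h0 : I.mkQ (g (K.mkQ 1)) = 0 := by simpa using hle (Submodule.mem_sup_left hN)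
    have h1I : (1 : R) ∈ I := by simpa using h1.symm.trans h0
    exact hI.1 (eq_top_iff.2 fun r _ => by simpa using I.smul_mem (op r) h1I)
  obtain ⟨t, ht, k, hk, htk⟩ := Submodule.mem_sup.1 (htop ▸ Submodule.mem_top : (1 : R) ∈ N ⊔ K)
  have hm : e * r * (1 - e) ∈ K := by
    change e * r * (1 - e) * e = 0
    rw [mul_assoc, hidem.one_sub_mul_self, mul_zero]
  calc e * r * (1 - e) = (t + k) * (e * r * (1 - e)) := by rw [htk, one_mul]
    _ = t * (e * r * (1 - e)) + (k * e) * (r * (1 - e)) := by noncomm_ring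
    _ = 0 := by rw [ht _ hm, mem_leftAnnihilator.1 hk, zero_mul, add_zero]

theorem isSemisimpleRing_or_isRightSmall (hind : IsIndecomposableRing R) (hs : IsSemilocal R)
    (hR : IsRightSemihereditary R) (hQF : IsRightMaxQF R) :
    IsSemisimpleRing R ∨ IsRightSmall R := by
  refine or_iff_not_imp_right.2 fun hsmall => ?_
  obtain ⟨e, hmem, hidem, hmul⟩ := exists_isIdempotentElem_injectiveTrace hR hs
  have he : ∀ r, e * (r * e) = r * e := fun r => hmul _ (mul_left_mem_injectiveTrace r hmem)
  have hJ : ∀ j ∈ Ring.jacobson R, j * e = 0 := fun j hj => jacobson_mul_eq_zero hR hmem hmul hj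
  have hcomm : ∀ r, r * e = e * r := by
    intro r
    have := mul_mul_one_sub_eq_zero hQF hs hidem he hJ r
    rw [mul_sub, mul_one, mul_assoc, he, sub_eq_zero] at this
    exact this.symm
  have hne : e ≠ 0 := by
    rintro rfl
    obtain ⟨E, _, _, i, hi⟩ := exists_isInjectiveHull (S := Rᵐᵒᵖ) R
    obtain ⟨I, hI, f, hf⟩ := exists_map_ne_zero_of_not_isSmallSubmodule i
      fun h => hsmall ⟨E, _, _, i, hi, h⟩
    obtain ⟨g, rfl⟩ := hQF E hi.injective_module I hI f
    refine hf (LinearMap.ext fun y => ?_)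
    have hgy : g y = 0 := by
      rw [← hmul (g y) ⟨E, _, _, hi.injective_module, g, y, rfl⟩, zero_mul]
    simp [hgy]
  have he1 : e = 1 := (hind.2 e hidem (Subring.mem_center_iff.2 hcomm)).resolve_left hne
  subst he1
  have hbot : Ring.jacobson R = ⊥ := by
    rw [eq_bot_iff]
    intro j hj
    simpa using hJ j hj
  have : IsSemisimpleRing (R ⧸ Ring.jacobson R) := hs
  refine RingEquiv.isSemisimpleRing (R := R ⧸ Ring.jacobson R)
    (RingEquiv.ofBijective (Ideal.Quotient.mk (Ring.jacobson R))
      ⟨?_, Ideal.Quotient.mk_surjective⟩).symm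
  rw [injective_iff_map_eq_zero]
  intro x hx
  rw [Ideal.Quotient.eq_zero_iff_mem, hbot] at hx
  exact hx

theorem isRightMaxQF_iff_of_isIndecomposableRing (hind : IsIndecomposableRing R)
    (hs : IsSemilocal R) (hR : IsRightSemihereditary R) :
    IsRightMaxQF R ↔ IsSemisimpleRing R ∨ IsRightSmall R := by
  refine ⟨isSemisimpleRing_or_isRightSmall hind hs hR, ?_⟩
  rintro (h | h)
  · exact isRightMaxQF_of_isSemisimpleRing
  · exact isRightMaxQF_of_isRightSmall h

/-! ### Local rings -/

section Local

theorem isSemisimpleRing_of_isDivisionRing (h : IsDivisionRing R) : IsSemisimpleRing R := by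
  have := h.1
  let := DivisionRing.ofIsUnitOrEqZero (R := R) fun a => or_iff_not_imp_right.2 (h.2 a)
  infer_instance

variable [IsLocalRing R]

theorem eq_zero_or_eq_one_of_isIdempotentElem {e : R} (he : IsIdempotentElem e) :
    e = 0 ∨ e = 1 := by
  rcases IsLocalRing.isUnit_or_isUnit_of_add_one (add_sub_cancel e 1) with h | h
  · exact Or.inr (h.mul_left_cancel (by rw [he.eq, mul_one]))
  · exact Or.inl (h.mul_left_cancel (by rw [he.one_sub_mul_self, mul_zero]))

theorem isUnit_of_mul_eq_one_left {x z : R} (h : z * x = 1) : IsUnit x := by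
  have hidem : IsIdempotentElem (x * z) := by
    rw [IsIdempotentElem, mul_assoc, ← mul_assoc z, h, one_mul]
  rcases eq_zero_or_eq_one_of_isIdempotentElem hidem with h0 | h1
  · have : (1 : R) = 0 := by
      calc (1 : R) = z * (x * z) * x := by rw [← mul_assoc, h, one_mul, h]
        _ = 0 := by rw [h0, mul_zero, zero_mul]
    exact absurd this one_ne_zero
  · exact ⟨⟨x, z, h1, h⟩, rfl⟩

theorem isUnit_of_notMem_jacobson {x : R} (hx : x ∉ Ring.jacobson R) : IsUnit x := by
  rw [← Ideal.jacobson_bot, Ideal.mem_jacobson_iff] at hx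
  push Not at hx
  obtain ⟨y, hy⟩ := hx
  have hnot : ¬ IsUnit (y * x + 1) := by
    rintro ⟨v, hv⟩
    refine hy (v⁻¹ : Rˣ) ?_
    rw [Ideal.mem_bot, sub_eq_zero, mul_assoc]
    calc ((v⁻¹ : Rˣ) : R) * (y * x) + (v⁻¹ : Rˣ) = (v⁻¹ : Rˣ) * (y * x + 1) := by noncomm_ring
      _ = 1 := by rw [← hv, Units.inv_mul]
  have hu : IsUnit (-(y * x)) :=
    (IsLocalRing.isUnit_or_isUnit_of_add_one (a := y * x + 1) (b := -(y * x))
      (by abel)).resolve_left hnot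
  obtain ⟨v, hv⟩ := hu
  refine isUnit_of_mul_eq_one_left (z := -((v⁻¹ : Rˣ) * y)) ?_
  calc -((v⁻¹ : Rˣ) * y) * x = (v⁻¹ : Rˣ) * -(y * x) := by noncomm_ring
    _ = 1 := by rw [← hv, Units.inv_mul]

theorem isSemilocal_of_isLocalRing : IsSemilocal R := by
  refine isSemisimpleRing_of_isDivisionRing ⟨?_, fun a ha => ?_⟩
  · exact Ideal.Quotient.nontrivial_iff.2 (Ring.jacobson_lt_top R).ne
  · obtain ⟨x, rfl⟩ := Ideal.Quotient.mk_surjective a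
    refine (isUnit_of_notMem_jacobson fun hx => ha ?_).map (Ideal.Quotient.mk (Ring.jacobson R))
    exact Ideal.Quotient.eq_zero_iff_mem.2 hx

theorem isSemisimpleRing_iff_isDivisionRing_of_isLocalRing :
    IsSemisimpleRing R ↔ IsDivisionRing R := by
  refine ⟨fun h => ⟨inferInstance, fun a ha => isUnit_of_notMem_jacobson ?_⟩,
    isSemisimpleRing_of_isDivisionRing⟩
  rwa [IsSemisimpleRing.jacobson_eq_bot, Ideal.mem_bot]

end Local

end MaxQF

theorem mainTheorem7 (R : Type u) [Ring R] :
    (MaxQF.IsIndecomposableRing R → MaxQF.IsSemilocal R → MaxQF.IsRightSemihereditary R →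
      (MaxQF.IsRightMaxQF R ↔ IsSemisimpleRing R ∨ MaxQF.IsRightSmall R)) ∧
    (IsLocalRing R → MaxQF.IsRightSemihereditary R →
      (MaxQF.IsRightMaxQF R ↔ MaxQF.IsRightSmall R ∨ MaxQF.IsDivisionRing R)) := by
  refine ⟨MaxQF.isRightMaxQF_iff_of_isIndecomposableRing, fun hloc hR => ?_⟩
  rw [MaxQF.isRightMaxQF_iff_of_isIndecomposableRing
    ⟨inferInstance, fun e he _ => MaxQF.eq_zero_or_eq_one_of_isIdempotentElem he⟩
    MaxQF.isSemilocal_of_isLocalRing hR,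
    MaxQF.isSemisimpleRing_iff_isDivisionRing_of_isLocalRing, or_comm]
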